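/- For permutations $p=(p_1,\dots,p_n)$ of $\{1,\dots,n\}$ and $q=(q_1,\dots,q_k)$ of $\{1,\dots,k\}$, say that $p$ contains the pattern $q$ if there are positions $1\le i_1<i_2<\cdots<i_k\le n$ such that, for all $a,b\in\{1,\dots,k\}$, $p_{i_a}<p_{i_b}$ if and only if $q_a<q_b$; otherwise $p$ avoids $q$. Let $S_n(q)$ denote the number of permutations of $\{1,\dots,n\}$ that avoid $q$. Then, for every integer $n\ge 1$, $$S_n(1342)<8^n .$$ -/

import Mathlib

/-- The permutation `p` of length `n` contains the pattern `q` of length `k`: there are positions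
`i 0 < i 1 < ⋯ < i (k-1)` such that the entries of `p` in these positions are in the same
relative order as the entries of `q`. -/
def ContainsPattern {n k : ℕ} (p : Equiv.Perm (Fin n)) (q : Equiv.Perm (Fin k)) : Prop :=
  ∃ i : Fin k → Fin n, StrictMono i ∧ ∀ a b : Fin k, p (i a) < p (i b) ↔ q a < q b

/-- The permutation `p` avoids the pattern `q`. -/
def AvoidsPattern {n k : ℕ} (p : Equiv.Perm (Fin n)) (q : Equiv.Perm (Fin k)) : Prop :=
  ¬ ContainsPattern p q

/-- `numAvoiding n q` is the number `S_n(q)` of permutations of length `n` that avoid `q`. -/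
noncomputable def numAvoiding (n : ℕ) {k : ℕ} (q : Equiv.Perm (Fin k)) : ℕ :=
  Nat.card {p : Equiv.Perm (Fin n) // AvoidsPattern p q}

/-- The permutation 1342 in one-line notation, with positions and entries counted from `0`. -/
def pattern1342 : Equiv.Perm (Fin 4) where
  toFun := ![0, 2, 3, 1]
  invFun := ![0, 3, 1, 2]
  left_inv := by decide
  right_inv := by decide

/-!
Write a permutation of length `n` as the list of its entries `0, …, n - 1`. As 1342 is
skew-indecomposable, a list avoids 1342 iff each block of its skew decomposition does. So with
`iₙ` the number of skew-indecomposable avoiders of length `n` and `sₙ` the number of all avoiders,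
`sₙ = ∑ₐ iₐ sₙ₋ₐ`, of which `card_avoiders_le` records the inequality `≤`. It suffices to show
`∑ iₙ / 8 ^ n ≤ 5 / 32`: then `sₙ / 8 ^ n ≤ 5 / 32` for all `n ≥ 1`, by induction.

To count the skew-indecomposable avoiders, remove the maximum. A new maximum may be inserted
between `A` and `B` without creating a 1342 exactly if no 132-pattern has its first two entries in
`A` and its last entry in `B`; such a site is called active. The label of a list is the number of
its active sites, the one at the front excluded. Let `l = A ++ n :: B` be a skew-indecomposable
avoider with maximum `n` and length at least two.

* If `A ++ B` is skew-indecomposable, then the active sites of `l` are those of `A ++ B` up to the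
  place where `n` is inserted, and the site at the end (`label_insert_max`). So `l` is determined
  by `A ++ B` and the label of `l`, and this label is at least `2` and at most one more than the
  label of `A ++ B`.
* Otherwise let `P` be the first block of `A ++ B`. It lies inside `A`, and `l = P ++ R` where `R`
  is a skew-indecomposable avoider of length at least two; the label is additive
  (`exists_split_first_block`).

For the generating function `T(x, u)` of skew-indecomposable avoiders by length and label, the two
cases give `T - x u = T (T - x u) + x u² (T(x, 1) - T) / (1 - u)`. At `x = 1 / 8` and
`T(x, 1) = 5 / 32` this is a quadratic equation for `T` with discriminant `(1 - 3 u / 4)³`, and one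
of its solutions is the series `(1 - 7 u / 8 - (1 - 3 u / 4) ^ (3 / 2)) / (2 (1 - u))`. Its
coefficients `tₖ` are nonnegative and have partial sums at most `5 / 32` (`majorantTail_nonneg`).
The recurrence is monotone, so induction on `N` bounds by `tₖ` the sum of `8 ^ (-n)` over the
skew-indecomposable avoiders of label `k` and length `n ≤ N` (`sum_weight_le`), and summation
over `k` finishes the proof.
-/

open scoped List

namespace Avoid1342

/-! ### Lists avoiding 1342, active sites and skew-indecomposability -/

/-- The list `l` avoids 1342: no four of its entries, from left to right, are in the relative order
of 1342. -/
def Avoids (l : List ℕ) : Prop :=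
  ∀ a b c d, [a, b, c, d] <+ l → a < d → d < b → ¬ b < c

/-- The list is nonempty and skew-indecomposable: it has no cut `A ++ B` into nonempty parts with
no entry of `A` below an entry of `B`. -/
def Indec (l : List ℕ) : Prop :=
  l ≠ [] ∧ ∀ A B, l = A ++ B → A ≠ [] → B ≠ [] → ∃ a ∈ A, ∃ b ∈ B, a < b

/-- The site between `A` and `B` in the list `A ++ B` is active: no 132-pattern has its first two
entries in `A` and its last entry in `B`. -/
def Active (A B : List ℕ) : Prop :=
  ∀ a c, [a, c] <+ A → ∀ b ∈ B, a < b → ¬ b < c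

open Classical in
/-- The number of active sites of `l`, not counting the site in front of all entries. The site
after entry number `i` (from `0`) is the one between `l.take (i + 1)` and `l.drop (i + 1)`. -/
noncomputable def label (l : List ℕ) : ℕ :=
  ((Finset.range l.length).filter fun i => Active (l.take (i + 1)) (l.drop (i + 1))).card

lemma Avoids.sublist {l l' : List ℕ} (h : Avoids l) (hs : l' <+ l) : Avoids l' :=
  fun a b c d hl => h a b c d (hl.trans hs)

lemma Avoids.of_map {f : ℕ → ℕ} (hf : StrictMono f) {l : List ℕ} (h : Avoids (l.map f)) :
    Avoids l := fun a b c d hl h1 h2 h3 =>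
  h (f a) (f b) (f c) (f d) (by simpa using hl.map f) (hf h1) (hf h2) (hf h3)

lemma Indec.of_map {f : ℕ → ℕ} (hf : StrictMono f) {l : List ℕ} (h : Indec (l.map f)) :
    Indec l := by
  refine ⟨fun h0 => h.1 (by simp [h0]), fun A B hl hA hB => ?_⟩
  obtain ⟨a, ha, b, hb, hab⟩ := h.2 (A.map f) (B.map f) (by simp [hl]) (by simpa) (by simpa)
  obtain ⟨a, ha', rfl⟩ := List.mem_map.1 ha
  obtain ⟨b, hb', rfl⟩ := List.mem_map.1 hb
  exact ⟨a, ha', b, hb', hf.lt_iff_lt.1 hab⟩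

lemma active_map {f : ℕ → ℕ} (hf : StrictMono f) (A B : List ℕ) :
    Active (A.map f) (B.map f) ↔ Active A B := by
  constructor
  · intro h a c hac b hb h1 h2
    exact h (f a) (f c) (by simpa using hac.map f) (f b) (List.mem_map_of_mem hb) (hf h1) (hf h2)
  · intro h a c hac b hb h1 h2
    obtain ⟨l, hl, hl'⟩ := List.sublist_map_iff.1 hac
    obtain ⟨b, hb', rfl⟩ := List.mem_map.1 hb
    match l, hl' with
    | [x, y], hl' =>
      simp only [List.map_cons, List.map_nil, List.cons.injEq, and_true] at hl'
      obtain ⟨rfl, rfl⟩ := hl'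
      exact h x y hl b hb' (hf.lt_iff_lt.1 h1) (hf.lt_iff_lt.1 h2)

lemma label_map {f : ℕ → ℕ} (hf : StrictMono f) (l : List ℕ) : label (l.map f) = label l := by
  classical
  unfold label
  simp only [List.length_map, ← List.map_take, ← List.map_drop, active_map hf]

/-- The site at the end is always active. -/
lemma label_pos {l : List ℕ} (h : l ≠ []) : 1 ≤ label l := by
  classical
  have h0 := List.length_pos_iff.2 h
  refine Finset.card_pos.2 ⟨l.length - 1, ?_⟩
  have : l.length - 1 + 1 = l.length := by omega
  simp [this, Active, h0]

/-- The 132-patterns of `P ++ R` lie in `P` or in `R` if every entry of `R` that exceeds some entry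
of `P` is a maximum, so the active sites of `P ++ R` are those of `P` and those of `R`. -/
lemma label_append {P R : List ℕ}
    (h : ∀ a ∈ P, ∀ b ∈ R, a < b → ∀ c ∈ P ++ R, c ≤ b) :
    label (P ++ R) = label P + label R := by
  classical
  unfold label
  rw [List.length_append, Finset.range_eq_Ico,
    ← Finset.Ico_union_Ico_eq_Ico (Nat.zero_le P.length) (Nat.le_add_right _ _),
    Finset.filter_union, Finset.card_union_of_disjoint]
  · congr 1
    · rw [← Finset.range_eq_Ico]
      congr 1
      refine Finset.filter_congr fun i hi => ?_
      have hi : i + 1 ≤ P.length := by simpa using hi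
      rw [List.take_append_of_le_length hi, List.drop_append_of_le_length hi]
      refine ⟨fun H a c hac b hb => H a c hac b (by simp [hb]), fun H a c hac b hb h1 h2 => ?_⟩
      rcases List.mem_append.1 hb with hb | hb
      · exact H a c hac b hb h1 h2
      · have hs := hac.trans (List.take_sublist _ _)
        have := h a (hs.subset (by simp)) b hb h1 c
          (List.mem_append_left _ (hs.subset (by simp)))
        omega
    · refine Eq.trans ?_ (Finset.card_map (addLeftEmbedding P.length))
      congr 1
      ext i
      simp only [Finset.mem_filter, Finset.mem_Ico, Finset.mem_map, Finset.mem_range,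
        addLeftEmbedding_apply]
      have key : ∀ j, Active ((P ++ R).take (P.length + j + 1)) ((P ++ R).drop (P.length + j + 1)) ↔
          Active (R.take (j + 1)) (R.drop (j + 1)) := by
        intro j
        rw [add_assoc, List.take_length_add_append, List.drop_length_add_append]
        constructor
        · exact fun H a c hac => H a c (hac.trans (List.sublist_append_right _ _))
        · intro H a c hac b hb h1 h2
          obtain ⟨l₁, l₂, hl, hl₁, hl₂⟩ := List.sublist_append_iff.1 hac
          have hbR : b ∈ R := List.mem_of_mem_drop hb
          have hc : c ∈ P ++ R := by
            have : c ∈ P ++ R.take (j + 1) := hac.subset (by simp)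
            exact ((List.Sublist.refl P).append (List.take_sublist _ _)).subset this
          match l₁, hl with
          | [], hl => exact H a c (by rw [hl]; simpa using hl₂) b hb h1 h2
          | x :: l, hl =>
            have hx : a = x := by simp at hl; exact hl.1
            have := h a (hl₁.subset (by simp [hx])) b hbR h1 c hc
            omega
      constructor
      · rintro ⟨⟨h1, h2⟩, h3⟩
        refine ⟨i - P.length, ⟨by omega, ?_⟩, by omega⟩
        rw [← key]
        rwa [show P.length + (i - P.length) = i by omega]
      · rintro ⟨j, ⟨h1, h2⟩, rfl⟩
        exact ⟨⟨by omega, by omega⟩, (key j).2 h2⟩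
  · exact (Finset.Ico_disjoint_Ico_consecutive _ _ _).mono (Finset.filter_subset _ _)
      (Finset.filter_subset _ _)

/-- A nonempty list has a skew-indecomposable first block. -/
lemma exists_first_block (l : List ℕ) (hl : l ≠ []) (hnd : l.Nodup) :
    ∃ A B, l = A ++ B ∧ Indec A ∧ ∀ a ∈ A, ∀ b ∈ B, b < a := by
  induction hn : l.length using Nat.strong_induction_on generalizing l with
  | _ n ih =>
    by_cases hI : Indec l
    · exact ⟨l, [], by simp, hI, by simp⟩
    · unfold Indec at hI
      push Not at hI
      obtain ⟨A, B, rfl, hA, hB, hAB⟩ := hI hl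
      have hBl := List.length_pos_iff.2 hB
      obtain ⟨A₁, A₂, rfl, hA₁, h12⟩ := ih A.length (by simp at hn; omega) A hA
        (hnd.sublist (List.sublist_append_left _ _)) rfl
      refine ⟨A₁, A₂ ++ B, by simp, hA₁, fun a ha b hb => ?_⟩
      rcases List.mem_append.1 hb with hb | hb
      · exact h12 a ha b hb
      · have ha' : a ∈ A₁ ++ A₂ := by simp [ha]
        have : a ≠ b := (List.nodup_append.1 hnd).2.2 a ha' b hb
        have := hAB a ha' b hb
        omega

/-- To the right of its maximum, a skew-indecomposable list has no active site but the last. -/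
lemma Indec.eq_nil_of_active {C D : List ℕ} {n : ℕ} (hI : Indec (C ++ D)) (hnd : (C ++ D).Nodup)
    (hn : n ∈ C) (hmax : ∀ b ∈ D, b < n) (hact : Active C D) : D = [] := by
  by_contra hD
  -- Let `m` be the largest entry of `D`, and cut before the first entry of `C` below `m`.
  obtain ⟨m, hm, hmD⟩ : ∃ m ∈ D, ∀ b ∈ D, b ≤ m := by
    obtain ⟨m, hm, h⟩ := D.toFinset.exists_max_image id (by simpa using hD)
    exact ⟨m, by simpa using hm, by simpa using h⟩
  have hCm : ∀ c ∈ C, c ≠ m := fun c hc => (List.nodup_append.1 hnd).2.2 c hc m hm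
  have hC : C = C.takeWhile (m < ·) ++ C.dropWhile (m < ·) := List.takeWhile_append_dropWhile.symm
  have h1 : ∀ c ∈ C.takeWhile (m < ·), m < c := fun c hc => by
    simpa using List.mem_takeWhile_imp hc
  have h2 : ∀ c ∈ C.dropWhile (m < ·), c ≤ m := by
    intro c hc
    match hd : C.dropWhile (m < ·) with
    | [] => simp [hd] at hc
    | x :: l =>
      have hx : ¬ m < x := by
        have := List.head_dropWhile_not (fun c => decide (m < c)) (l := C) (by simp [hd])
        simpa [hd] using this
      rw [hd] at hc
      rcases List.mem_cons.1 hc with rfl | hc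
      · omega
      · have hs : [x, c] <+ C := by
          refine List.Sublist.trans ?_ (List.dropWhile_sublist (fun c => decide (m < c)))
          rw [hd]
          exact (List.singleton_sublist.2 hc).cons_cons x
        have hxm : x ≠ m := hCm x (hs.subset (by simp))
        have := hact x c hs m hm (by omega)
        omega
  have h3 : C.takeWhile (m < ·) ≠ [] := by
    match C, hn with
    | x :: l, hn =>
      have hx : m < x := by
        rcases List.mem_cons.1 hn with rfl | hn
        · exact hmax m hm
        · have hs : [x, n] <+ x :: l := (List.singleton_sublist.2 hn).cons_cons x
          have := hact x n hs m hm
          have := hmax m hm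
          have := hCm x (by simp)
          omega
      simp [hx]
  obtain ⟨a, ha, b, hb, hab⟩ := hI.2 (C.takeWhile (m < ·)) (C.dropWhile (m < ·) ++ D)
    (by rw [← List.append_assoc, ← hC]) h3 (by simp [hD])
  have := h1 a ha
  rcases List.mem_append.1 hb with hb | hb
  · have := h2 b hb
    omega
  · have := hmD b hb
    omega

open Classical in
/-- The active sites among the `j` leftmost sites of `l`, the front excluded. -/
noncomputable def sitesUpTo (l : List ℕ) (j : ℕ) : Finset ℕ :=
  (Finset.range j).filter fun i => Active (l.take (i + 1)) (l.drop (i + 1))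

/-- Suppose that the skew-indecomposable list `l` has maximum `n`. Its active sites to the left of
`n` are those of the list without `n`, and the only other one is at the end. -/
lemma label_insert_max {A B : List ℕ} {n : ℕ} (hnd : (A ++ n :: B).Nodup)
    (hmax : ∀ x ∈ A ++ B, x < n) (hI : Indec (A ++ n :: B)) :
    label (A ++ n :: B) = (sitesUpTo (A ++ B) A.length).card + 1 := by
  classical
  unfold label
  have hlen : (A ++ n :: B).length = A.length + B.length + 1 := by simp; omega
  rw [hlen, Finset.range_add_one, Finset.filter_insert, if_pos, Finset.card_insert_of_notMem
    (by simp)]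
  · congr 2
    ext i
    simp only [sitesUpTo, Finset.mem_filter, Finset.mem_range]
    constructor
    · rintro ⟨hi, hact⟩
      have hiA : i < A.length := by
        by_contra hcon
        have hsplit := List.take_append_drop (i + 1) (A ++ n :: B)
        have := Indec.eq_nil_of_active (n := n) (by rwa [hsplit]) (by rwa [hsplit]) ?_ ?_ hact
        · have := congrArg List.length this
          rw [List.length_drop, hlen] at this
          simp at this
          omega
        · obtain ⟨j, rfl⟩ : ∃ j, i = A.length + j := ⟨i - A.length, by omega⟩
          rw [add_assoc, List.take_length_add_append]
          simp
        · obtain ⟨j, rfl⟩ : ∃ j, i = A.length + j := ⟨i - A.length, by omega⟩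
          intro b hb
          rw [add_assoc, List.drop_length_add_append, List.drop_succ_cons] at hb
          exact hmax b (by simp [List.mem_of_mem_drop hb])
      refine ⟨hiA, ?_⟩
      rw [List.take_append_of_le_length hiA, List.drop_append_of_le_length hiA] at hact ⊢
      exact fun a c hac b hb => hact a c hac b (by
        rcases List.mem_append.1 hb with hb | hb <;> simp [hb])
    · rintro ⟨hiA, hact⟩
      refine ⟨by omega, ?_⟩
      rw [List.take_append_of_le_length hiA, List.drop_append_of_le_length hiA] at hact ⊢
      intro a c hac b hb h1 h2
      have hc : c < n := hmax c (List.mem_append_left _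
        ((hac.trans (List.take_sublist _ _)).subset (by simp)))
      refine hact a c hac b ?_ h1 h2
      simp only [List.mem_append, List.mem_cons] at hb ⊢
      rcases hb with hb | rfl | hb
      · exact Or.inl hb
      · omega
      · exact Or.inr hb
  · rw [List.drop_eq_nil_of_le (by simp; omega)]
    simp [Active]

/-- A 132-pattern around the maximum would form a 1342 with it. -/
lemma Avoids.active_of_max {A B : List ℕ} {n : ℕ} (h : Avoids (A ++ n :: B))
    (hmax : ∀ x ∈ A, x < n) : Active A B := by
  intro a c hac b hb h1 h2
  have hs : [a, c, n, b] <+ A ++ n :: B := by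
    have := hac.append ((List.singleton_sublist.2 hb).cons_cons n)
    simpa using this
  exact h a c n b hs h1 h2 (hmax c (hac.subset (by simp)))

/-- A skew-indecomposable list is determined by its label and by what is left when its maximum is
removed. -/
lemma insert_max_injective {A B A' B' : List ℕ} {n : ℕ}
    (hnd : (A ++ n :: B).Nodup) (hnd' : (A' ++ n :: B').Nodup)
    (hmax : ∀ x ∈ A ++ B, x < n)
    (hI : Indec (A ++ n :: B)) (hI' : Indec (A' ++ n :: B'))
    (hav : Avoids (A ++ n :: B)) (hav' : Avoids (A' ++ n :: B'))
    (heq : A ++ B = A' ++ B') (hlab : label (A ++ n :: B) = label (A' ++ n :: B')) :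
    A ++ n :: B = A' ++ n :: B' := by
  wlog hle : A.length ≤ A'.length generalizing A B A' B'
  · exact (this hnd' hnd (heq ▸ hmax) hI' hI hav' hav heq.symm hlab.symm (by omega)).symm
  have hact : Active A' B' := hav'.active_of_max fun x hx => hmax x (by simp [heq, hx])
  rw [label_insert_max hnd hmax hI, label_insert_max hnd' (heq ▸ hmax) hI', ← heq] at hlab
  rcases hle.eq_or_lt with hlen | hlt
  · obtain ⟨rfl, rfl⟩ := List.append_inj heq hlen
    rfl
  · exfalso
    have : (sitesUpTo (A ++ B) A.length).card < (sitesUpTo (A ++ B) A'.length).card := by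
      classical
      refine Finset.card_lt_card (Finset.ssubset_iff_of_subset ?_ |>.2 ⟨A'.length - 1, ?_, ?_⟩)
      · exact Finset.filter_subset_filter _ (Finset.range_mono hle)
      · have : A'.length - 1 + 1 = A'.length := by omega
        simp only [sitesUpTo, Finset.mem_filter, Finset.mem_range, this, heq,
          List.take_left, List.drop_left]
        exact ⟨by omega, hact⟩
      · simp only [sitesUpTo, Finset.mem_filter, Finset.mem_range, not_and]
        omega
    omega

/-- If all entries of `A` exceed all entries of `B`, then `B` consists of the smallest values and
`A` is a shifted permutation. -/
lemma perm_split {A B : List ℕ} {n : ℕ} (h : A ++ B ~ List.range n)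
    (hlt : ∀ a ∈ A, ∀ b ∈ B, b < a) :
    B ~ List.range B.length ∧
      ∃ A', A' ~ List.range A.length ∧ A = A'.map (· + B.length) := by
  have hnd : (A ++ B).Nodup := h.nodup_iff.2 List.nodup_range
  obtain ⟨hA, hB, hAB⟩ := List.nodup_append.1 hnd
  have hBlt : ∀ b ∈ B, b < B.length := by
    intro b hb
    have hsub : Finset.range (b + 1) ⊆ B.toFinset := by
      intro x hx
      have hx : x ≤ b := by simpa [Nat.lt_succ_iff] using hx
      have hbn : b < n := by simpa using h.subset (List.mem_append_right A hb)
      have : x ∈ A ++ B := h.mem_iff.2 (by simp; omega)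
      rcases List.mem_append.1 this with hxA | hxB
      · have := hlt x hxA b hb
        omega
      · simpa using hxB
    have := Finset.card_le_card hsub
    rwa [Finset.card_range, List.toFinset_card_of_nodup hB] at this
  have hBp : B ~ List.range B.length :=
    (List.subperm_of_subset hB fun b hb => by simpa using hBlt b hb).perm_of_length_le (by simp)
  have hAge : ∀ a ∈ A, B.length ≤ a := by
    intro a ha
    by_contra hcon
    exact hAB a ha a (hBp.mem_iff.2 (by simpa using hcon)) rfl
  have hn : A.length + B.length = n := by simpa using h.length_eq
  have hmap : A = (A.map (· - B.length)).map (· + B.length) := by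
    rw [List.map_map]
    conv_lhs => rw [← List.map_id A]
    refine List.map_congr_left fun a ha => ?_
    have := hAge a ha
    simp; omega
  refine ⟨hBp, A.map (· - B.length), ?_, hmap⟩
  refine (List.subperm_of_subset ?_ ?_).perm_of_length_le (by simp)
  · rw [hmap] at hA
    exact hA.of_map
  · intro x hx
    obtain ⟨a, ha, rfl⟩ := List.mem_map.1 hx
    have := hAge a ha
    have : a < n := by simpa using h.subset (List.mem_append_left B ha)
    simp; omega

/-! ### The majorant: a solution of the functional equation at `x = 1 / 8` -/

open PowerSeries in
/-- The power series `(1 - 3 u / 4) ^ (3 / 2)`. -/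
noncomputable def rootSeries : PowerSeries ℝ :=
  rescale (-3 / 4 : ℝ) (PowerSeries.binomialSeries ℝ (3 / 2 : ℝ))

/-- The coefficients `rₙ` of `(1 - 3 u / 4) ^ (3 / 2)`. -/
noncomputable def rootCoeff (n : ℕ) : ℝ := PowerSeries.coeff n rootSeries

open PowerSeries in
lemma rootSeries_sq : rootSeries * rootSeries =
    1 - C (9 / 4 : ℝ) * X + C (27 / 16 : ℝ) * X ^ 2 - C (27 / 64 : ℝ) * X ^ 3 := by
  have h : PowerSeries.binomialSeries ℝ (3 / 2 : ℝ) * PowerSeries.binomialSeries ℝ (3 / 2 : ℝ) =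
      (1 + X) ^ 3 := by
    rw [← binomialSeries_add, show (3 / 2 + 3 / 2 : ℝ) = ((3 : ℕ) : ℝ) by norm_num,
      binomialSeries_nat]
  rw [rootSeries, ← map_mul, h, map_pow, map_add, map_one, rescale_X]
  have h1 : (C (9 / 4 : ℝ)) = -3 * C (-3 / 4 : ℝ) := by
    rw [show (-3 : PowerSeries ℝ) = C (-3 : ℝ) by rw [map_neg, map_ofNat], ← map_mul]; norm_num
  have h2 : (C (27 / 16 : ℝ)) = 3 * C (-3 / 4 : ℝ) ^ 2 := by
    rw [show (3 : PowerSeries ℝ) = C (3 : ℝ) from (map_ofNat C 3).symm, ← map_pow, ← map_mul]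
    norm_num
  have h3 : (C (27 / 64 : ℝ)) = - C (-3 / 4 : ℝ) ^ 3 := by
    rw [← map_pow, ← map_neg]; norm_num
  rw [h1, h2, h3]
  ring

lemma rootCoeff_zero : rootCoeff 0 = 1 := by
  simp [rootCoeff, rootSeries]

lemma rootCoeff_succ (n : ℕ) :
    (n + 1) * rootCoeff (n + 1) = 3 / 4 * (n - 3 / 2) * rootCoeff n := by
  have h := Ring.choose_smul_choose (3 / 2 : ℝ) (Nat.le_succ n)
  simp only [Nat.succ_eq_add_one, Nat.choose_succ_self_right, add_tsub_cancel_left,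
    Ring.choose_one_right, nsmul_eq_mul, Nat.cast_add, Nat.cast_one] at h
  simp only [rootCoeff, rootSeries, PowerSeries.coeff_rescale,
    PowerSeries.binomialSeries_coeff, smul_eq_mul, mul_one, pow_succ]
  linear_combination (-3 / 4 : ℝ) ^ n * (-3 / 4) * h

lemma rootCoeff_one : rootCoeff 1 = -9 / 8 := by
  have := rootCoeff_succ 0
  rw [rootCoeff_zero] at this
  norm_num at this
  linarith

lemma rootCoeff_pos (n : ℕ) : 0 < rootCoeff (n + 2) := by
  induction n with
  | zero =>
    have := rootCoeff_succ 1
    rw [rootCoeff_one] at this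
    norm_num at this ⊢
    linarith
  | succ n ih =>
    have h := rootCoeff_succ (n + 2)
    push_cast at h
    have h1 : (0 : ℝ) < (n + 2 + 1) * rootCoeff (n + 2 + 1) := by
      rw [h]
      have : (0 : ℝ) ≤ n := n.cast_nonneg
      exact mul_pos (by linarith) ih
    exact pos_of_mul_pos_right h1 (by positivity)

lemma rootCoeff_succ_le (n : ℕ) : rootCoeff (n + 3) ≤ 3 / 4 * rootCoeff (n + 2) := by
  have h := rootCoeff_succ (n + 2)
  push_cast at h
  have h0 := rootCoeff_pos n
  have h1 := rootCoeff_pos (n + 1)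
  have : (0 : ℝ) ≤ n := n.cast_nonneg
  have h2 : ((n : ℝ) + 2 + 1) * rootCoeff (n + 3) ≤ (n + 2 + 1) * (3 / 4 * rootCoeff (n + 2)) := by
    rw [h]
    nlinarith
  exact le_of_mul_le_mul_left h2 (by positivity)

lemma rootCoeff_add_le (n k : ℕ) : rootCoeff (n + k + 2) ≤ rootCoeff (n + 2) * (3 / 4) ^ k := by
  induction k with
  | zero => simp
  | succ k ih =>
    have := rootCoeff_succ_le (n + k)
    rw [pow_succ, show n + (k + 1) + 2 = n + k + 3 by ring]
    linarith

lemma summable_rootCoeff_add (n : ℕ) : Summable fun k => rootCoeff (n + k + 2) :=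
  Summable.of_nonneg_of_le (fun _ => (rootCoeff_pos _).le) (rootCoeff_add_le n)
    ((summable_geometric_of_lt_one (by norm_num) (by norm_num)).mul_left _)

lemma summable_rootCoeff : Summable rootCoeff := by
  rw [← summable_nat_add_iff 2]
  simpa using summable_rootCoeff_add 0

/-- The coefficients satisfy `(∑ rₙ)² = (1 - 3 / 4)³`; positivity of `rₙ` for `n ≥ 2` selects the
positive root. -/
lemma tsum_rootCoeff : ∑' n, rootCoeff n = 1 / 8 := by
  have hn : Summable fun n => ‖rootCoeff n‖ := by
    rw [← summable_nat_add_iff 2]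
    refine (summable_rootCoeff_add 0).congr fun n => ?_
    rw [Real.norm_of_nonneg (rootCoeff_pos n).le, zero_add]
  have hval : (∑' n, rootCoeff n) * ∑' n, rootCoeff n = 1 / 64 := by
    rw [tsum_mul_tsum_eq_tsum_sum_antidiagonal_of_summable_norm hn hn]
    simp only [rootCoeff, ← PowerSeries.coeff_mul, rootSeries_sq]
    rw [tsum_eq_sum (s := Finset.range 4)]
    · simp [Finset.sum_range_succ, -map_sub]
      norm_num
    · intro n hn
      have hn : 4 ≤ n := by simpa using hn
      simp [PowerSeries.coeff_X, PowerSeries.coeff_X_pow, PowerSeries.coeff_one,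
        PowerSeries.coeff_C_mul, show n ≠ 0 by omega, show n ≠ 1 by omega, show n ≠ 2 by omega,
        show n ≠ 3 by omega]
  have hgt : -1 / 8 ≤ ∑' n, rootCoeff n := by
    rw [← summable_rootCoeff.sum_add_tsum_nat_add 2]
    have : 0 ≤ ∑' n, rootCoeff (n + 2) := tsum_nonneg fun n => (rootCoeff_pos n).le
    simp only [Finset.sum_range_succ, Finset.range_zero, Finset.sum_empty, rootCoeff_zero,
      rootCoeff_one]
    linarith
  have hne : -1 / 8 ≠ ∑' n, rootCoeff n := by
    have : 0 < ∑' n, rootCoeff (n + 2) := by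
      have hs := (summable_nat_add_iff 2).2 summable_rootCoeff
      exact hs.tsum_pos (fun n => (rootCoeff_pos n).le) 0 (rootCoeff_pos 0)
    rw [← summable_rootCoeff.sum_add_tsum_nat_add 2]
    simp only [Finset.sum_range_succ, Finset.range_zero, Finset.sum_empty, rootCoeff_zero,
      rootCoeff_one]
    linarith
  have hlt := lt_of_le_of_ne hgt hne
  have : (∑' n, rootCoeff n - 1 / 8) * (∑' n, rootCoeff n + 1 / 8) = 0 := by
    linear_combination hval
  rcases mul_eq_zero.1 this with h | h <;> linarith

/-- The coefficients `tⱼ` of the series `T = (1 - 7 u / 8 - (1 - 3 u / 4) ^ (3 / 2)) / (2 (1 - u))`,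
written as tails `tⱼ = (rⱼ₊₁ + rⱼ₊₂ + ⋯) / 2` for `j ≥ 1`, which shows that they are nonnegative. -/
noncomputable def majorant : ℕ → ℝ
  | 0 => 0
  | j + 1 => 1 / 2 * ∑' n, rootCoeff (j + n + 2)

lemma majorant_zero : majorant 0 = 0 := rfl

lemma majorant_nonneg (j : ℕ) : 0 ≤ majorant j := by
  cases j with
  | zero => exact le_rfl
  | succ j =>
    exact mul_nonneg (by norm_num) (tsum_nonneg fun n => (rootCoeff_pos _).le)

lemma majorant_one : majorant 1 = 1 / 8 := by
  have h := summable_rootCoeff.sum_add_tsum_nat_add 2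
  rw [tsum_rootCoeff] at h
  simp only [Finset.sum_range_succ, Finset.range_zero, Finset.sum_empty, rootCoeff_zero,
        rootCoeff_one] at h
  simp only [majorant, zero_add]
  linarith

lemma majorant_add_two (j : ℕ) :
    majorant (j + 2) = majorant (j + 1) - 1 / 2 * rootCoeff (j + 2) := by
  simp only [majorant]
  rw [(summable_rootCoeff_add j).tsum_eq_zero_add]
  have : ∀ n, j + 1 + n + 2 = j + (n + 1) + 2 := fun n => by ring
  simp only [this, add_zero]
  ring

lemma majorant_succ_le (j : ℕ) : majorant (j + 1) ≤ rootCoeff 2 * 2 * (3 / 4) ^ j := by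
  have h1 : ∑' n, rootCoeff (j + n + 2) ≤ ∑' n, rootCoeff (j + 2) * (3 / 4) ^ n :=
    (summable_rootCoeff_add j).tsum_le_tsum (rootCoeff_add_le j)
      ((summable_geometric_of_lt_one (by norm_num) (by norm_num)).mul_left _)
  rw [tsum_mul_left, tsum_geometric_of_lt_one (by norm_num) (by norm_num)] at h1
  have h2 := rootCoeff_add_le 0 j
  simp only [zero_add] at h2
  simp only [majorant]
  norm_num at h1
  linarith

lemma summable_majorant : Summable majorant := by
  rw [← summable_nat_add_iff 1]
  exact Summable.of_nonneg_of_le (fun j => majorant_nonneg _) majorant_succ_le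
    ((summable_geometric_of_lt_one (by norm_num) (by norm_num)).mul_left _)

open PowerSeries in
/-- The power series `T = ∑ tⱼ u ^ j`. -/
noncomputable def majorantSeries : PowerSeries ℝ := mk majorant

open PowerSeries in
lemma majorantSeries_mul_one_sub :
    2 * (majorantSeries * (1 - X)) = 1 - C (7 / 8 : ℝ) * X - rootSeries := by
  ext n
  rw [show (2 : PowerSeries ℝ) = C (2 : ℝ) from (map_ofNat C 2).symm, coeff_C_mul, mul_sub,
    mul_one, map_sub]
  match n with
  | 0 =>
    have h0 : constantCoeff rootSeries = 1 := by
      rw [← coeff_zero_eq_constantCoeff_apply]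
      exact rootCoeff_zero
    simp [majorantSeries, majorant, h0]
  | 1 =>
    simp [majorantSeries, coeff_succ_mul_X, ← rootCoeff.eq_1, rootCoeff_one, majorant_one,
      coeff_one]
    norm_num [majorant]
  | j + 2 =>
    rw [coeff_succ_mul_X]
    simp [majorantSeries, coeff_succ_mul_X, ← rootCoeff.eq_1, majorant_add_two, coeff_one]

open PowerSeries in
/-- The functional equation at `x = 1 / 8`, with denominators cleared. -/
lemma majorantSeries_quadratic :
    (1 - X) * (majorantSeries - C (1 / 8 : ℝ) * X) * (1 - majorantSeries) =
      C (1 / 8 : ℝ) * X ^ 2 * (C (5 / 32 : ℝ) - majorantSeries) := by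
  have h := majorantSeries_mul_one_sub
  have hsq := rootSeries_sq
  have hR : rootSeries = 1 - C (7 / 8 : ℝ) * X - 2 * (majorantSeries * (1 - X)) := by
    rw [h]; ring
  rw [hR] at hsq
  have e1 : (C (7 / 8 : ℝ)) = 28 * C (1 / 32) := by
    rw [show (28 : PowerSeries ℝ) = C (28 : ℝ) from (map_ofNat C 28).symm, ← map_mul]; norm_num
  have e2 : (C (9 / 4 : ℝ)) = 72 * C (1 / 32) := by
    rw [show (72 : PowerSeries ℝ) = C (72 : ℝ) from (map_ofNat C 72).symm, ← map_mul]; norm_num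
  have e3 : (C (27 / 16 : ℝ)) = 54 * C (1 / 32) := by
    rw [show (54 : PowerSeries ℝ) = C (54 : ℝ) from (map_ofNat C 54).symm, ← map_mul]; norm_num
  have e4 : (C (27 / 64 : ℝ)) = 432 * C (1 / 32) ^ 2 := by
    rw [show (432 : PowerSeries ℝ) = C (432 : ℝ) from (map_ofNat C 432).symm, ← map_pow, ← map_mul]
    norm_num
  have e5 : (C (1 / 8 : ℝ)) = 4 * C (1 / 32) := by
    rw [show (4 : PowerSeries ℝ) = C (4 : ℝ) from (map_ofNat C 4).symm, ← map_mul]; norm_num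
  have e6 : (C (5 / 32 : ℝ)) = 5 * C (1 / 32) := by
    rw [show (5 : PowerSeries ℝ) = C (5 : ℝ) from (map_ofNat C 5).symm, ← map_mul]; norm_num
  have e7 : 32 * C (1 / 32 : ℝ) = 1 := by
    rw [show (32 : PowerSeries ℝ) = C (32 : ℝ) from (map_ofNat C 32).symm, ← map_mul]; norm_num
  rw [e1, e2, e3, e4] at hsq
  rw [e5, e6]
  generalize majorantSeries = T at *
  generalize (C (1 / 32 : ℝ)) = c at *
  have hX : (4 : PowerSeries ℝ) * (1 - X) ≠ 0 := by
    refine mul_ne_zero ?_ ?_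
    · rw [← map_ofNat (C (R := ℝ)) 4]
      intro h0
      simpa using congrArg constantCoeff h0
    · intro h0
      simpa using congrArg constantCoeff h0
  refine mul_left_cancel₀ hX ?_
  linear_combination -hsq + e7 * (4 * (1 - X) * X * T + 22 * c * X ^ 2 + 16 * c * X ^ 3)

/-- The number `5 / 32 - ∑_{j ≤ k} tⱼ`, the coefficient of `u ^ k` in `(5 / 32 - T) / (1 - u)`. -/
noncomputable def majorantTail (k : ℕ) : ℝ :=
  5 / 32 - ∑ j ∈ Finset.range (k + 1), majorant j

open PowerSeries in
/-- The functional equation at `x = 1 / 8`, solved for `T`. -/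
lemma majorantSeries_eq :
    majorantSeries = C (1 / 8 : ℝ) * X +
      majorantSeries * (majorantSeries - C (1 / 8 : ℝ) * X) +
      C (1 / 8 : ℝ) * (mk majorantTail * X ^ 2) := by
  have hV : mk majorantTail * (1 - X) = C (5 / 32 : ℝ) - majorantSeries := by
    ext n
    rw [mul_sub, mul_one, map_sub, map_sub]
    cases n with
    | zero => simp [majorantTail, majorantSeries]
    | succ n =>
      rw [coeff_succ_mul_X]
      simp [majorantTail, majorantSeries, Finset.sum_range_succ _ (n + 1)]
  have h := majorantSeries_quadratic
  rw [← hV] at h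
  have hX : (1 - X : PowerSeries ℝ) ≠ 0 := by
    intro h0
    simpa using congrArg constantCoeff h0
  refine mul_left_cancel₀ hX ?_
  linear_combination h

/-- The functional equation at `x = 1 / 8`, read off coefficientwise. -/
lemma majorant_rec (k : ℕ) :
    majorant (k + 2) = ∑ p ∈ Finset.HasAntidiagonal.antidiagonal (k + 2),
        majorant p.1 * (majorant p.2 - if p.2 = 1 then 1 / 8 else 0) +
      1 / 8 * majorantTail k := by
  have h := congrArg (PowerSeries.coeff (k + 2)) majorantSeries_eq
  rw [map_add, map_add, PowerSeries.coeff_C_mul, PowerSeries.coeff_C_mul,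
    PowerSeries.coeff_mul_X_pow, PowerSeries.coeff_mul, PowerSeries.coeff_X,
    if_neg (by omega)] at h
  simpa [majorantSeries, PowerSeries.coeff_X] using h

lemma majorantTail_nonneg (k : ℕ) : 0 ≤ majorantTail k := by
  -- The tails decrease, and the recurrence shows that their limit is `0`.
  have hanti : Antitone majorantTail := antitone_nat_of_succ_le fun n => by
    simp only [majorantTail, Finset.sum_range_succ _ (n + 1)]
    linarith [majorant_nonneg (n + 1)]
  have hn : Summable fun n => ‖majorant n‖ := summable_majorant.abs
  have hsub : Summable fun n => ‖majorant n - if n = 1 then 1 / 8 else 0‖ := by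
    refine (summable_majorant.sub ?_).abs
    exact summable_of_ne_finset_zero (s := {1}) fun n hn => by simp at hn; simp [hn]
  have hconv := (summable_norm_sum_mul_antidiagonal_of_summable_norm hn hsub).of_norm
  have h1 := (summable_majorant.tendsto_atTop_zero.comp (Filter.tendsto_add_atTop_nat 2)).sub
    (hconv.tendsto_atTop_zero.comp (Filter.tendsto_add_atTop_nat 2))
  have h2 : Filter.Tendsto majorantTail Filter.atTop (nhds 0) := by
    have := h1.const_mul 8
    simp only [sub_zero, mul_zero] at this
    refine this.congr fun k => ?_
    simp only [Function.comp_apply]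
    rw [majorant_rec]
    ring
  exact hanti.le_of_tendsto h2 k

/-! ### Recurrences for the numbers of avoiders -/

open Classical in
/-- The permutations of `0, …, n - 1`, as lists, that avoid 1342. -/
noncomputable def avoiders (n : ℕ) : Finset (List ℕ) :=
  (List.range n).permutations.toFinset.filter Avoids

open Classical in
/-- The skew-indecomposable 1342-avoiders of length `n`. -/
noncomputable def indecs (n : ℕ) : Finset (List ℕ) := (avoiders n).filter Indec

open Classical in
/-- The skew-indecomposable 1342-avoiders of length `n` with label `k`. -/
noncomputable def indecsWithLabel (n k : ℕ) : Finset (List ℕ) :=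
  (indecs n).filter fun l => label l = k

lemma mem_avoiders {n : ℕ} {l : List ℕ} : l ∈ avoiders n ↔ l ~ List.range n ∧ Avoids l := by
  simp [avoiders]

lemma mem_indecs {n : ℕ} {l : List ℕ} :
    l ∈ indecs n ↔ l ~ List.range n ∧ Avoids l ∧ Indec l := by
  simp [indecs, mem_avoiders, and_assoc]

lemma mem_indecsWithLabel {n k : ℕ} {l : List ℕ} :
    l ∈ indecsWithLabel n k ↔ l ∈ indecs n ∧ label l = k := by
  simp [indecsWithLabel]

lemma strictMono_add_shift (m : ℕ) : StrictMono (· + m) := fun _ _ h => Nat.add_lt_add_right h m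

lemma indecs_zero : indecs 0 = ∅ := by
  ext l
  simp only [mem_indecs, List.range_zero, List.perm_nil, Finset.notMem_empty, iff_false]
  exact fun h => h.2.2.1 h.1

lemma label_pos_of_mem_indecs {n : ℕ} {l : List ℕ} (h : l ∈ indecs n) : 1 ≤ label l :=
  label_pos (mem_indecs.1 h).2.2.1

lemma indecsWithLabel_one_subset (k : ℕ) :
    indecsWithLabel 1 k ⊆ if k = 1 then {[0]} else ∅ := by
  intro l hl
  obtain ⟨h, rfl⟩ := mem_indecsWithLabel.1 hl
  have h1 : l = [0] := by simpa using (mem_indecs.1 h).1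
  have h2 : label l ≤ 1 := by
    classical
    exact (Finset.card_filter_le _ _).trans (by simp [h1])
  have := label_pos_of_mem_indecs h
  rw [if_pos (by omega)]
  simpa using h1

/-- Every avoider is the skew sum of its first block and an avoider. -/
lemma card_avoiders_le (n : ℕ) :
    (avoiders (n + 1)).card ≤
      ∑ p ∈ Finset.HasAntidiagonal.antidiagonal n,
        (indecs (p.1 + 1)).card * (avoiders p.2).card := by
  classical
  have hsub : avoiders (n + 1) ⊆ (Finset.HasAntidiagonal.antidiagonal n).biUnion fun p =>
      (indecs (p.1 + 1) ×ˢ avoiders p.2).image fun q => q.1.map (· + p.2) ++ q.2 := by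
    intro l hl
    obtain ⟨hp, hav⟩ := mem_avoiders.1 hl
    have hne : l ≠ [] := by
      rintro rfl
      simpa using hp.length_eq
    obtain ⟨A, B, rfl, hA, hAB⟩ := exists_first_block l hne (hp.nodup_iff.2 List.nodup_range)
    obtain ⟨hB, A', hA', hAA'⟩ := perm_split hp hAB
    have hlen : A.length + B.length = n + 1 := by simpa using hp.length_eq
    have hpos := List.length_pos_iff.2 hA.1
    simp only [Finset.mem_biUnion, Finset.mem_image, Finset.mem_product,
      Finset.HasAntidiagonal.mem_antidiagonal]
    refine ⟨(A.length - 1, B.length), by omega, (A', B), ⟨mem_indecs.2 ⟨?_, ?_, ?_⟩,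
      mem_avoiders.2 ⟨hB, hav.sublist (List.sublist_append_right _ _)⟩⟩, by rw [hAA']⟩
    · rwa [Nat.sub_add_cancel hpos]
    · exact Avoids.of_map (strictMono_add_shift B.length)
        (hAA' ▸ hav.sublist (List.sublist_append_left _ _))
    · exact Indec.of_map (strictMono_add_shift B.length) (hAA' ▸ hA)
  refine (Finset.card_le_card hsub).trans (Finset.card_biUnion_le.trans ?_)
  refine Finset.sum_le_sum fun p _ => Finset.card_image_le.trans ?_
  rw [Finset.card_product]

/-- Removing the maximum of a list whose entries are `0, …, m`. -/
lemma exists_split_max {l : List ℕ} {m : ℕ} (hp : l ~ List.range (m + 1)) :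
    ∃ A B, l = A ++ m :: B ∧ A ++ B ~ List.range m ∧ ∀ x ∈ A ++ B, x < m := by
  obtain ⟨A, B, rfl⟩ := List.append_of_mem (hp.mem_iff.2 (by simp : m ∈ List.range (m + 1)))
  have h : A ++ B ~ List.range m := by
    have h1 : m :: (A ++ B) ~ m :: List.range m := by
      refine List.perm_middle.symm.trans (hp.trans ?_)
      rw [List.range_succ]
      exact List.perm_append_singleton _ _
    exact h1.cons_inv
  exact ⟨A, B, rfl, h, fun x hx => by simpa using h.subset hx⟩

open Classical in
/-- The skew-indecomposable 1342-avoiders of length `m + 1` with label `k` that stay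
skew-indecomposable when their maximum `m` is removed. -/
noncomputable def indecsEraseIndec (m k : ℕ) : Finset (List ℕ) :=
  (indecsWithLabel (m + 1) k).filter fun l => Indec (l.erase m)

lemma erase_max {A B : List ℕ} {m : ℕ} (hmax : ∀ x ∈ A ++ B, x < m) :
    (A ++ m :: B).erase m = A ++ B := by
  rw [List.erase_append_right, List.erase_cons_head]
  intro h
  exact (hmax m (by simp [h])).false

lemma card_indecsEraseIndec_le (m k : ℕ) :
    (indecsEraseIndec m (k + 2)).card ≤ ((indecs m).filter fun l => k + 1 ≤ label l).card := by
  classical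
  refine Finset.card_le_card_of_injOn (fun l => l.erase m) ?_ ?_
  · intro l hl
    simp only [indecsEraseIndec, Finset.coe_filter, Set.mem_ofPred_eq, mem_indecsWithLabel,
      mem_indecs] at hl
    obtain ⟨⟨⟨hp, hav, hI⟩, hlab⟩, hE⟩ := hl
    obtain ⟨A, B, rfl, hAB, hmax⟩ := exists_split_max hp
    rw [erase_max hmax] at hE
    simp only [erase_max hmax, Finset.coe_filter, Set.mem_ofPred_eq, mem_indecs]
    refine ⟨⟨hAB, hav.sublist ((List.sublist_cons_self m B).append_left A), hE⟩, ?_⟩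
    rw [label_insert_max (hp.nodup_iff.2 List.nodup_range) hmax hI] at hlab
    have : (sitesUpTo (A ++ B) A.length).card ≤ label (A ++ B) :=
      Finset.card_le_card (Finset.filter_subset_filter _ (Finset.range_mono (by simp)))
    omega
  · intro l hl l' hl' heq
    simp only [indecsEraseIndec, Finset.coe_filter, Set.mem_ofPred_eq, mem_indecsWithLabel,
      mem_indecs] at hl hl'
    obtain ⟨⟨⟨hp, hav, hI⟩, hlab⟩, -⟩ := hl
    obtain ⟨⟨⟨hp', hav', hI'⟩, hlab'⟩, -⟩ := hl'
    obtain ⟨A, B, rfl, hAB, hmax⟩ := exists_split_max hp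
    obtain ⟨A', B', rfl, hAB', hmax'⟩ := exists_split_max hp'
    simp only [erase_max hmax, erase_max hmax'] at heq
    exact insert_max_injective (hp.nodup_iff.2 List.nodup_range)
      (hp'.nodup_iff.2 List.nodup_range) hmax hI hI' hav hav' heq (hlab.trans hlab'.symm)

/-- If removing the maximum leaves a single block, then an active site precedes the maximum, so the
label is at least `2`. -/
lemma indecsEraseIndec_eq_empty {m k : ℕ} (hk : k ≤ 1) : indecsEraseIndec m k = ∅ := by
  classical
  rw [Finset.eq_empty_iff_forall_notMem]
  intro l hl
  simp only [indecsEraseIndec, Finset.mem_filter, mem_indecsWithLabel, mem_indecs] at hl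
  obtain ⟨⟨⟨hp, hav, hI⟩, hlab⟩, hE⟩ := hl
  obtain ⟨A, B, rfl, hAB, hmax⟩ := exists_split_max hp
  rw [erase_max hmax] at hE
  have hA : A ≠ [] := by
    rintro rfl
    obtain ⟨a, ha, b, hb, hab⟩ := hI.2 [m] B (by simp) (by simp) (by simpa using hE.1)
    have := hmax b (by simpa using hb)
    simp at ha
    omega
  rw [label_insert_max (hp.nodup_iff.2 List.nodup_range) hmax hI] at hlab
  have hpos := List.length_pos_iff.2 hA
  have : 0 < (sitesUpTo (A ++ B) A.length).card := by
    refine Finset.card_pos.2 ⟨A.length - 1, ?_⟩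
    simp only [sitesUpTo, Finset.mem_filter, Finset.mem_range, Nat.sub_add_cancel hpos,
      List.take_left, List.drop_left]
    exact ⟨by omega, hav.active_of_max fun x hx => hmax x (by simp [hx])⟩
  omega

/-- If removing the maximum `m + 1` leaves several blocks, then the first of them can be split
off. -/
lemma exists_split_first_block {l : List ℕ} {m : ℕ} (hl : l ∈ indecs (m + 2))
    (hE : ¬ Indec (l.erase (m + 1))) :
    ∃ a b P R, a + b = m ∧ P ∈ indecs a ∧ R ∈ indecs (b + 2) ∧ label l = label P + label R ∧
      l = P.map (· + (b + 1)) ++ R.map (fun x => if x ≤ b then x else x + a) := by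
  obtain ⟨hp, hav, hI⟩ := mem_indecs.1 hl
  obtain ⟨A, B, rfl, hAB, hmax⟩ := exists_split_max hp
  rw [erase_max hmax] at hE
  have hnd : (A ++ B).Nodup := hAB.nodup_iff.2 List.nodup_range
  have hlenAB : A.length + B.length = m + 1 := by simpa using hAB.length_eq
  obtain ⟨P, Q, hPQ, hP, hlt⟩ := exists_first_block (A ++ B)
    (by rw [← List.length_pos_iff]; simp; omega) hnd
  have hQ : Q ≠ [] := by
    rintro rfl
    rw [hPQ, List.append_nil] at hE
    exact hE hP
  -- The maximum lies to the right of the first block, as the list is indecomposable.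
  obtain ⟨A₂, rfl, rfl⟩ : ∃ A₂, A = P ++ A₂ ∧ Q = A₂ ++ B := by
    rcases List.append_eq_append_iff.1 hPQ with ⟨B₁, rfl, rfl⟩ | ⟨A₂, rfl, rfl⟩
    · obtain ⟨x, hx, y, hy, hxy⟩ := hI.2 (A ++ (m + 1) :: B₁) Q (by simp) (by simp) hQ
      have hym := hmax y (by simp [hy])
      simp only [List.mem_append, List.mem_cons] at hx
      rcases hx with hx | rfl | hx
      · have := hlt x (by simp [hx]) y hy
        omega
      · omega
      · have := hlt x (by simp [hx]) y hy
        omega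
    · exact ⟨A₂, rfl, rfl⟩
  rw [hPQ] at hAB
  obtain ⟨hQp, P', hP', hPP'⟩ := perm_split hAB hlt
  have hPpos := List.length_pos_iff.2 hP.1
  have hQpos := List.length_pos_iff.2 hQ
  obtain ⟨b, hb⟩ : ∃ b, (A₂ ++ B).length = b + 1 := ⟨(A₂ ++ B).length - 1, by omega⟩
  obtain ⟨a, ha⟩ : ∃ a, P.length = a := ⟨_, rfl⟩
  have hab : a + b = m := by simp at hlenAB hb; omega
  rw [hb] at hQp hPP'
  rw [ha] at hP'
  set f : ℕ → ℕ := fun x => if x ≤ b then x else x + a with hf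
  have hfm : StrictMono f := by
    intro x y hxy
    simp only [hf]
    split_ifs <;> omega
  have hQb : ∀ x ∈ A₂ ++ B, x ≤ b := fun x hx => by
    have := hQp.subset hx
    simp at this
    omega
  have hfQ : ∀ L : List ℕ, L ⊆ A₂ ++ B → L.map f = L := fun L hL => by
    conv_rhs => rw [← List.map_id L]
    exact List.map_congr_left fun x hx => by simp [hf, hQb x (hL hx)]
  have hR : (A₂ ++ (b + 1) :: B).map f = A₂ ++ (m + 1) :: B := by
    rw [List.map_append, List.map_cons, hfQ A₂ (by simp), hfQ B (by simp)]
    congr 2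
    simp [hf]
    omega
  have hl : P ++ A₂ ++ (m + 1) :: B =
      P'.map (· + (b + 1)) ++ (A₂ ++ (b + 1) :: B).map f := by
    rw [hR, ← hPP', List.append_assoc]
  have hIR : Indec (A₂ ++ (m + 1) :: B) := by
    refine ⟨by simp, fun C D hCD hC hD => ?_⟩
    obtain ⟨x, hx, y, hy, hxy⟩ := hI.2 (P ++ C) D
      (by rw [List.append_assoc, List.append_assoc, hCD]) (by simp [hC]) hD
    rcases List.mem_append.1 hx with hx | hx
    · have hy' : y ∈ A₂ ++ (m + 1) :: B := by rw [hCD]; simp [hy]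
      have hym : y = m + 1 := by
        by_contra hne
        have := hlt x hx y (by simpa [hne] using hy')
        omega
      -- The maximum lies in `D`, above everything in `C`.
      obtain ⟨c, hc⟩ := List.exists_mem_of_ne_nil C hC
      refine ⟨c, hc, y, hy, ?_⟩
      have hndR : (C ++ D).Nodup := by
        rw [← hCD]
        refine (hp.nodup_iff.2 List.nodup_range).sublist ?_
        rw [List.append_assoc]
        exact List.sublist_append_right _ _
      have hcy : c ≠ y := (List.nodup_append.1 hndR).2.2 c hc y hy
      have hc' : c ∈ A₂ ++ (m + 1) :: B := by rw [hCD]; simp [hc]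
      have hcQ : c ∈ A₂ ++ B := by simpa [← hym, hcy] using hc'
      have := hQb c hcQ
      omega
    · exact ⟨x, hx, y, hy, hxy⟩
  refine ⟨a, b, P', A₂ ++ (b + 1) :: B, hab, mem_indecs.2 ⟨hP', ?_, ?_⟩,
    mem_indecs.2 ⟨?_, ?_, ?_⟩, ?_, hl⟩
  · refine Avoids.of_map (strictMono_add_shift (b + 1)) (hPP' ▸ hav.sublist ?_)
    rw [List.append_assoc]
    exact List.sublist_append_left _ _
  · exact Indec.of_map (strictMono_add_shift (b + 1)) (hPP' ▸ hP)
  · refine List.perm_middle.trans ?_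
    rw [List.range_succ]
    exact (hQp.cons _).trans (List.perm_append_singleton _ _).symm
  · refine Avoids.of_map hfm (hR ▸ hav.sublist ?_)
    rw [List.append_assoc]
    exact List.sublist_append_right _ _
  · exact Indec.of_map hfm (hR ▸ hIR)
  · rw [← label_map (strictMono_add_shift (b + 1)) P', ← label_map hfm (A₂ ++ (b + 1) :: B), hR,
      ← hPP', List.append_assoc]
    refine label_append fun x hx y hy hxy c hc => ?_
    have hym : y = m + 1 := by
      by_contra hne
      have := hlt x hx y (by simpa [hne] using hy)
      omega
    have : c ∈ List.range (m + 1 + 1) := hp.subset (by rwa [List.append_assoc])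
    simp at this
    omega

lemma card_indecsWithLabel_le (m k : ℕ) :
    (indecsWithLabel (m + 2) k).card ≤ (indecsEraseIndec (m + 1) k).card +
      ∑ p ∈ Finset.HasAntidiagonal.antidiagonal m, ∑ q ∈ Finset.HasAntidiagonal.antidiagonal k,
        (indecsWithLabel p.1 q.1).card * (indecsWithLabel (p.2 + 2) q.2).card := by
  classical
  have hsub : indecsWithLabel (m + 2) k ⊆ indecsEraseIndec (m + 1) k ∪
      (Finset.HasAntidiagonal.antidiagonal m).biUnion fun p =>
        (Finset.HasAntidiagonal.antidiagonal k).biUnion fun q =>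
          (indecsWithLabel p.1 q.1 ×ˢ indecsWithLabel (p.2 + 2) q.2).image fun r =>
            r.1.map (· + (p.2 + 1)) ++ r.2.map (fun x => if x ≤ p.2 then x else x + p.1) := by
    intro l hl
    by_cases hE : Indec (l.erase (m + 1))
    · exact Finset.mem_union_left _ (Finset.mem_filter.2 ⟨hl, hE⟩)
    · refine Finset.mem_union_right _ ?_
      obtain ⟨hl, hk⟩ := mem_indecsWithLabel.1 hl
      obtain ⟨a, b, P, R, hab, hP, hR, hlab, heq⟩ := exists_split_first_block hl hE
      simp only [Finset.mem_biUnion, Finset.mem_image, Finset.mem_product,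
        Finset.HasAntidiagonal.mem_antidiagonal]
      exact ⟨(a, b), hab, (label P, label R), by rw [← hlab, hk], (P, R),
        ⟨mem_indecsWithLabel.2 ⟨hP, rfl⟩, mem_indecsWithLabel.2 ⟨hR, rfl⟩⟩, heq.symm⟩
  refine (Finset.card_le_card hsub).trans ((Finset.card_union_le _ _).trans ?_)
  refine Nat.add_le_add_left (Finset.card_biUnion_le.trans ?_) _
  refine Finset.sum_le_sum fun p _ => Finset.card_biUnion_le.trans ?_
  refine Finset.sum_le_sum fun q _ => Finset.card_image_le.trans ?_
  rw [Finset.card_product]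

/-! ### Bounding the numbers of avoiders -/

/-- The number of skew-indecomposable avoiders of length `n` with label `k`, divided by `8 ^ n`. -/
noncomputable def weight (n k : ℕ) : ℝ := (indecsWithLabel n k).card / 8 ^ n

lemma weight_nonneg (n k : ℕ) : 0 ≤ weight n k := by unfold weight; positivity

lemma weight_zero (k : ℕ) : weight 0 k = 0 := by
  simp [weight, indecsWithLabel, indecs_zero]

lemma weight_one_le (k : ℕ) : weight 1 k ≤ if k = 1 then 1 / 8 else 0 := by
  have h := Finset.card_le_card (indecsWithLabel_one_subset k)
  unfold weight
  split_ifs with hk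
  · rw [if_pos hk, Finset.card_singleton] at h
    have : ((indecsWithLabel 1 k).card : ℝ) ≤ 1 := by exact_mod_cast h
    rw [pow_one]
    gcongr
  · rw [if_neg hk, Finset.card_empty] at h
    simp [Nat.le_zero.1 h]

lemma weight_add_two_le (m k : ℕ) :
    weight (m + 2) k ≤ (indecsEraseIndec (m + 1) k).card / 8 ^ (m + 2) +
      ∑ q ∈ Finset.HasAntidiagonal.antidiagonal k, ∑ p ∈ Finset.HasAntidiagonal.antidiagonal m,
        weight p.1 q.1 * weight (p.2 + 2) q.2 := by
  have h := (Nat.cast_le (α := ℝ)).2 (card_indecsWithLabel_le m k)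
  have h' := div_le_div_of_nonneg_right h (by positivity : (0 : ℝ) ≤ 8 ^ (m + 2))
  refine h'.trans (le_of_eq ?_)
  push_cast
  rw [add_div, Finset.sum_comm, Finset.sum_div]
  congr 1
  refine Finset.sum_congr rfl fun q _ => ?_
  rw [Finset.sum_div]
  refine Finset.sum_congr rfl fun p hp => ?_
  rw [← Finset.HasAntidiagonal.mem_antidiagonal.1 hp, weight, weight, div_mul_div_comm, ← pow_add,
    add_assoc]

lemma sum_antidiagonal_le {f g : ℕ → ℝ} (hf : ∀ n, 0 ≤ f n) (hg : ∀ n, 0 ≤ g n) (N : ℕ) :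
    ∑ m ∈ Finset.range N, ∑ p ∈ Finset.HasAntidiagonal.antidiagonal m, f p.1 * g p.2 ≤
      (∑ a ∈ Finset.range N, f a) * ∑ b ∈ Finset.range N, g b := by
  simp only [Finset.Nat.sum_antidiagonal_eq_sum_range_succ (fun i j => f i * g j)]
  rw [Finset.sum_range_diag_flip N fun i j => f i * g j, Finset.sum_mul]
  refine Finset.sum_le_sum fun a _ => ?_
  rw [← Finset.mul_sum]
  exact mul_le_mul_of_nonneg_left (Finset.sum_le_sum_of_subset_of_nonneg
    (Finset.range_mono (Nat.sub_le _ _)) fun _ _ _ => hg _) (hf a)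

lemma sum_range_weight_le {N : ℕ}
    (hN : ∀ k, ∑ b ∈ Finset.range N, weight (b + 2) k ≤ majorant k - if k = 1 then 1 / 8 else 0)
    (k : ℕ) : ∑ a ∈ Finset.range (N + 1), weight (a + 1) k ≤ majorant k := by
  rw [Finset.sum_range_succ']
  linarith [hN k, weight_one_le k]

/-- A bound for the number of lists by label gives one for the lists with label at least `k`, since
`5 / 32` bounds the partial sums of the majorant. -/
lemma sum_card_label_ge_le {N : ℕ}
    (hN : ∀ k, ∑ a ∈ Finset.range N, weight (a + 1) k ≤ majorant k) (k : ℕ) :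
    ∑ a ∈ Finset.range N, (((indecs (a + 1)).filter fun l => k ≤ label l).card : ℝ) / 8 ^ (a + 1) ≤
      5 / 32 - ∑ j ∈ Finset.range k, majorant j := by
  classical
  have h1 : ∀ a ∈ Finset.range N,
      (((indecs (a + 1)).filter fun l => k ≤ label l).card : ℝ) / 8 ^ (a + 1) ≤
        ∑ j ∈ Finset.Ico k (k + N + 1), weight (a + 1) j := by
    intro a ha
    have hsub : (indecs (a + 1)).filter (fun l => k ≤ label l) ⊆
        (Finset.Ico k (k + N + 1)).biUnion fun j => indecsWithLabel (a + 1) j := by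
      intro l hl
      obtain ⟨hl, hk⟩ := Finset.mem_filter.1 hl
      have hlen : l.length = a + 1 := by simpa using (mem_indecs.1 hl).1.length_eq
      have hlab : label l ≤ l.length := by
        simpa [label] using Finset.card_filter_le (Finset.range l.length) _
      have := Finset.mem_range.1 ha
      exact Finset.mem_biUnion.2 ⟨label l, Finset.mem_Ico.2 ⟨hk, by omega⟩,
        mem_indecsWithLabel.2 ⟨hl, rfl⟩⟩
    have hcard : (((indecs (a + 1)).filter fun l => k ≤ label l).card : ℝ) ≤
        ∑ j ∈ Finset.Ico k (k + N + 1), ((indecsWithLabel (a + 1) j).card : ℝ) := by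
      exact_mod_cast (Finset.card_le_card hsub).trans Finset.card_biUnion_le
    simp only [weight, ← Finset.sum_div]
    gcongr
  have htail := majorantTail_nonneg (k + N)
  rw [majorantTail, Finset.range_eq_Ico,
    ← Finset.sum_Ico_consecutive _ (Nat.zero_le k) (by omega : k ≤ k + N + 1)] at htail
  calc _ ≤ ∑ a ∈ Finset.range N, ∑ j ∈ Finset.Ico k (k + N + 1), weight (a + 1) j :=
        Finset.sum_le_sum h1
    _ = ∑ j ∈ Finset.Ico k (k + N + 1), ∑ a ∈ Finset.range N, weight (a + 1) j := Finset.sum_comm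
    _ ≤ ∑ j ∈ Finset.Ico k (k + N + 1), majorant j := Finset.sum_le_sum fun j _ => hN j
    _ ≤ _ := by
      rw [Finset.range_eq_Ico]
      linarith

/-- The majorization. Length one is left out of the sum because the right factor of the recurrence
has length at least two; its share is subtracted from the majorant. -/
lemma sum_weight_le (N : ℕ) : ∀ k, ∑ b ∈ Finset.range N, weight (b + 2) k ≤
    majorant k - if k = 1 then 1 / 8 else 0 := by
  induction N with
  | zero =>
    intro k
    split_ifs with hk
    · simp [hk, majorant_one]
    · simpa using majorant_nonneg k
  | succ N ih =>
    intro k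
    have hG := sum_range_weight_le ih
    have hconv : ∑ m ∈ Finset.range (N + 1), ∑ q ∈ Finset.HasAntidiagonal.antidiagonal k,
        ∑ p ∈ Finset.HasAntidiagonal.antidiagonal m, weight p.1 q.1 * weight (p.2 + 2) q.2 ≤
        ∑ q ∈ Finset.HasAntidiagonal.antidiagonal k,
          majorant q.1 * (majorant q.2 - if q.2 = 1 then 1 / 8 else 0) := by
      rw [Finset.sum_comm]
      refine Finset.sum_le_sum fun q _ => ?_
      -- The first factor vanishes at length `0`, so the second never has length `N + 2`.
      rw [Finset.sum_range_succ']
      simp only [Finset.Nat.antidiagonal_succ, Finset.sum_cons, Finset.sum_map, weight_zero,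
        Finset.Nat.antidiagonal_zero, Finset.sum_singleton, zero_mul, add_zero, zero_add,
        Function.Embedding.prodMap, Function.Embedding.coeFn_mk, Prod.map,
        Function.Embedding.refl_apply, Nat.succ_eq_add_one]
      refine (sum_antidiagonal_le (f := fun a => weight (a + 1) q.1)
        (g := fun b => weight (b + 2) q.2) (fun _ => weight_nonneg _ _)
        (fun _ => weight_nonneg _ _) N).trans ?_
      refine mul_le_mul ?_ (ih q.2) (Finset.sum_nonneg fun _ _ => weight_nonneg _ _)
        (majorant_nonneg _)
      exact (Finset.sum_le_sum_of_subset_of_nonneg (Finset.range_mono (Nat.le_succ N))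
        fun _ _ _ => weight_nonneg _ _).trans (hG q.1)
    have hsum := Finset.sum_le_sum fun m (_ : m ∈ Finset.range (N + 1)) => weight_add_two_le m k
    rw [Finset.sum_add_distrib] at hsum
    match k with
    | 0 =>
      simp [indecsEraseIndec_eq_empty, majorant_zero] at hconv hsum ⊢
      linarith
    | 1 =>
      simp [indecsEraseIndec_eq_empty, majorant_one, majorant_zero,
        Finset.Nat.antidiagonal_succ] at hconv hsum ⊢
      linarith
    | k + 2 =>
      have hE : ∑ m ∈ Finset.range (N + 1),
          ((indecsEraseIndec (m + 1) (k + 2)).card : ℝ) / 8 ^ (m + 2) ≤ 1 / 8 * majorantTail k := by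
        refine le_trans ?_ (mul_le_mul_of_nonneg_left (sum_card_label_ge_le hG (k + 1))
          (by norm_num))
        rw [Finset.mul_sum]
        refine Finset.sum_le_sum fun m _ => ?_
        rw [pow_succ, ← div_div, one_div, mul_comm, ← div_eq_mul_inv]
        exact div_le_div_of_nonneg_right (div_le_div_of_nonneg_right
          (Nat.cast_le.2 (card_indecsEraseIndec_le (m + 1) k)) (by positivity)) (by norm_num)
      rw [if_neg (by omega), majorant_rec]
      linarith

lemma sum_card_indecs_le (N : ℕ) :
    ∑ a ∈ Finset.range N, ((indecs (a + 1)).card : ℝ) / 8 ^ (a + 1) ≤ 5 / 32 := by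
  have h := sum_card_label_ge_le (sum_range_weight_le (sum_weight_le N)) 0
  simp only [Nat.zero_le, Finset.filter_true, Finset.range_zero, Finset.sum_empty, sub_zero] at h
  exact (Finset.sum_le_sum_of_subset_of_nonneg (Finset.range_mono (Nat.le_succ N))
    fun _ _ _ => by positivity).trans h

lemma card_avoiders_zero : (avoiders 0).card ≤ 1 := by
  refine Finset.card_le_one.2 fun l hl l' hl' => ?_
  have h := (mem_avoiders.1 hl).1
  have h' := (mem_avoiders.1 hl').1
  simp only [List.range_zero, List.perm_nil] at h h'
  rw [h, h']

lemma card_avoiders_succ_div_le (n : ℕ) :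
    ((avoiders (n + 1)).card : ℝ) / 8 ^ (n + 1) ≤ 5 / 32 := by
  induction n using Nat.strong_induction_on with
  | _ n ih =>
    have hle : ∀ m ≤ n, ((avoiders m).card : ℝ) / 8 ^ m ≤ 1 := by
      intro m hm
      cases m with
      | zero => simpa using card_avoiders_zero
      | succ m => exact (ih m hm).trans (by norm_num)
    have h := (Nat.cast_le (α := ℝ)).2 (card_avoiders_le n)
    have h' := div_le_div_of_nonneg_right h (by positivity : (0 : ℝ) ≤ 8 ^ (n + 1))
    refine h'.trans (le_trans ?_ (sum_card_indecs_le (n + 1)))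
    push_cast
    rw [Finset.sum_div, ← Finset.Nat.sum_antidiagonal_eq_sum_range_succ
      (fun i _ => ((indecs (i + 1)).card : ℝ) / 8 ^ (i + 1))]
    refine Finset.sum_le_sum fun p hp => ?_
    have hp := Finset.HasAntidiagonal.mem_antidiagonal.1 hp
    rw [show n + 1 = p.1 + 1 + p.2 by omega, pow_add, ← div_mul_div_comm]
    exact mul_le_of_le_one_right (by positivity) (hle p.2 (by omega))

/-! ### One-line notation -/

/-- The one-line notation of a permutation, with entries counted from `0`. -/
def oneLine {n : ℕ} (p : Equiv.Perm (Fin n)) : List ℕ := List.ofFn fun i => (p i : ℕ)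

lemma oneLine_injective {n : ℕ} : Function.Injective (oneLine (n := n)) := by
  intro p q h
  ext i
  exact congrFun (List.ofFn_injective h) i

lemma oneLine_perm {n : ℕ} (p : Equiv.Perm (Fin n)) : oneLine p ~ List.range n := by
  refine (List.subperm_of_subset ?_ ?_).perm_of_length_le (by simp [oneLine])
  · exact List.nodup_ofFn.2 (Fin.val_injective.comp p.injective)
  · intro x hx
    obtain ⟨i, rfl⟩ := (List.mem_ofFn' _ _).1 hx
    simp

lemma avoids_oneLine {n : ℕ} {p : Equiv.Perm (Fin n)} (hp : AvoidsPattern p pattern1342) :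
    Avoids (oneLine p) := by
  intro a b c d hs had hdb hbc
  obtain ⟨f, hf⟩ := List.sublist_iff_exists_fin_orderEmbedding_get_eq.1 hs
  refine hp ⟨fun x => Fin.cast (by simp [oneLine]) (f (Fin.cast (by simp) x)), ?_, ?_⟩
  · intro x y hxy
    simpa using hxy
  · have hval : ∀ x : Fin 4,
        ((p (Fin.cast (by simp [oneLine]) (f (Fin.cast (by simp) x))) : Fin n) : ℕ) =
          [a, b, c, d].get (Fin.cast (by simp) x) := by
      intro x
      rw [hf]
      simp [oneLine]
      rfl
    intro x y
    rw [Fin.lt_def, hval, hval]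
    fin_cases x <;> fin_cases y <;> simp [pattern1342] <;> omega

lemma numAvoiding_le (n : ℕ) : numAvoiding n pattern1342 ≤ (avoiders n).card := by
  rw [numAvoiding, ← Nat.card_eq_finsetCard]
  refine Nat.card_le_card_of_injective
    (fun p => ⟨oneLine p.1, mem_avoiders.2 ⟨oneLine_perm p.1, avoids_oneLine p.2⟩⟩) ?_
  intro p q h
  exact Subtype.ext (oneLine_injective (congrArg Subtype.val h))

end Avoid1342

theorem mainTheorem6 (n : ℕ) (hn : 1 ≤ n) : numAvoiding n pattern1342 < 8 ^ n := by
  obtain ⟨m, rfl⟩ : ∃ m, n = m + 1 := ⟨n - 1, by omega⟩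
  have h := Avoid1342.card_avoiders_succ_div_le m
  rw [div_le_iff₀ (by positivity)] at h
  have h8 : (0 : ℝ) < 8 ^ (m + 1) := by positivity
  have hlt : ((Avoid1342.avoiders (m + 1)).card : ℝ) < 8 ^ (m + 1) := by linarith
  exact (Avoid1342.numAvoiding_le _).trans_lt (by exact_mod_cast hlt)
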